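/- **Setting.** Let $m\in\{2,6,10,14,\dots\}$. An $m$-uniform hypergraph $\mathcal G=(\mathcal V,\mathcal E)$ on $\mathcal V=[n]$ has as hyperedges $m$-element subsets of $[n]$. Let $\mathcal H$ be the set of all $m/2$-element subsets of $[n]$ and $N=|\mathcal H|$. For $S\subseteq\mathcal H$ let $$\partial S=\{e\in\mathcal E : e=h_1\cup h_2,\ h_1\in S,\ h_2\in\mathcal H\setminus S,\ h_1\cap h_2=\emptyset\}.$$ For $d\in\mathbb N$ and $c>0$, $\mathcal G$ is called a *$d$-regular expander hypergraph with constant $c$* if $|\partial S|\ge c\,d\,|S|$ for every $S\subseteq\mathcal H$ with $0<|S|\le N/2$. **Model.** Let $y^\ast\in\{+1,-1\}^n$ be the unknown labels. For each $e\in\mathcal E$ a value $x_e$ is observed, which equals $\prod_{i\in e}y^\ast_i$ with probability $1-p$ and $-\prod_{i\in e}y^\ast_i$ with probability $p$, independently over the hyperedges. The tensor $X\in\mathbb R^{n^{\otimes m}}$ has entries $X_{i_1,\dots,i_m}=x_e$ if $e=\{i_1,\dots,i_m\}\in\mathcal E$, and $0$ otherwise. For each vertex $i$ a value $z_i$ is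 observed, which equals $y^\ast_i$ with probability $1-q$ and $-y^\ast_i$ with probability $q$, independently over the vertices. **Two-stage approach.** Stage one solves the convex program of maximizing $\langle X,Y\rangle$ over all tensors $Y\in\mathbb R^{n^{\otimes m}}$ of the form $Y=\sum_{k=1}^{\binom{m+n-1}{m}}(v^{(k)})^{\otimes m}$ with $v^{(k)}\in\mathbb R^n$, such that $Y_{i_1,\dots,i_m}=1$ whenever every index occurs an even number of times in $(i_1,\dots,i_m)$, and $-1\le Y_{i_1,\dots,i_m}\le 1$ for all other tuples with a repeated index. Stage two maximizes $z^\top w$ over the $w\in\{+1,-1\}^n$ with $w^{\otimes m}=Y$, where $Y$ is the solution of stage one. *Exact inference* is the event that $(y^\ast)^{\otimes m}$ is the unique optimal solution in stage one and $y^\ast$ is the unique maximizer in stage two. **Statement.** Fix such an $m$, and $0\le p,q<1/2$, $c>0$, and a sequence $d=d(n)$ of natural numbers with $$d(n)\in\Omega\bigl(n\,(\log n)^{1/(2m)}\bigr)\qquad(n\to\infty).$$ Then there is a sequence $\rho_n\to1$ such that, for every $n$, every $d(n)$-regular expander $m$-uniform hypergraph on $[n]$ with constant $c$ and every $y^\ast\in\{+1,-1\}^n$,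 exact inference occurs with probability at least $\rho_n$. -/

import Mathlib

open MeasureTheory ProbabilityTheory Filter Asymptotics
open scoped Topology

noncomputable section

namespace HypergraphInference

/-! ### Hypergraphs and hyperedge expansion -/

/-- An `m`-uniform hypergraph on the vertex set `Fin n`. -/
structure UniformHypergraph (n m : ℕ) where
  edges : Finset (Finset (Fin n))
  sized : (edges : Set (Finset (Fin n))).Sized m

/-- The induced hypervertices: all sets of `m / 2` vertices. -/
def hypervertices (n m : ℕ) : Finset (Finset (Fin n)) :=
  Finset.powersetCard (m / 2) Finset.univ

/-- The boundary of a set `S` of hypervertices: the hyperedges `e` of `G` that split as a disjoint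
union of a hypervertex in `S` and a hypervertex outside `S`. -/
def boundary {n m : ℕ} (G : UniformHypergraph n m) (S : Finset (Finset (Fin n))) :
    Finset (Finset (Fin n)) :=
  {e ∈ G.edges | ∃ h₁ ∈ S, ∃ h₂ ∈ hypervertices n m \ S, Disjoint h₁ h₂ ∧ e = h₁ ∪ h₂}

/-- `G` is a `d`-regular expander hypergraph with constant `c`: every nonempty set `S` of at most
half of the hypervertices has at least `c * d * |S|` boundary hyperedges. -/
def IsRegularExpander {n m : ℕ} (G : UniformHypergraph n m) (d : ℕ) (c : ℝ) : Prop :=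
  ∀ S ⊆ hypervertices n m, 0 < S.card → (S.card : ℝ) ≤ ((hypervertices n m).card : ℝ) / 2 →
    c * d * S.card ≤ ((boundary G S).card : ℝ)

/-! ### The generative model -/

/-- `y` is a labeling with values `+1` and `-1`. -/
def IsLabeling {n : ℕ} (y : Fin n → ℝ) : Prop := ∀ i, y i = 1 ∨ y i = -1

/-- Real tensors of order `m` and dimension `n`. -/
abbrev Tensor (n m : ℕ) : Type := (Fin m → Fin n) → ℝ

/-- The symmetric observation tensor built from hyperedge observations `x`: the entry
`(i₁, …, iₘ)` is `x e` if `e = {i₁, …, iₘ}` is a hyperedge, and `0` otherwise. (As all hyperedges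
have `m` elements, entries with a repeated index are `0`.) -/
def observationTensor {n m : ℕ} (G : UniformHypergraph n m) (x : Finset (Fin n) → ℝ) :
    Tensor n m :=
  fun i ↦ if Finset.univ.image i ∈ G.edges then x (Finset.univ.image i) else 0

/-- The random variables `x e` (`e` a hyperedge of `G`) and `z i` (`i` a vertex) are noisy
observations of the labeling `y`: each `x e` is the product of the labels in `e`, flipped with
probability `p`, independently over the hyperedges; each `z i` is the label of `i`, flipped with
probability `q`, independently over the vertices. -/
structure IsObservation {n m : ℕ} (G : UniformHypergraph n m) (y : Fin n → ℝ) (p q : ℝ)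
    {Ω : Type*} [MeasurableSpace Ω] (μ : Measure Ω)
    (x : Finset (Fin n) → Ω → ℝ) (z : Fin n → Ω → ℝ) : Prop where
  edge_measurable : ∀ e ∈ G.edges, Measurable (x e)
  edge_correct : ∀ e ∈ G.edges, μ.real {ω | x e ω = ∏ i ∈ e, y i} = 1 - p
  edge_flipped : ∀ e ∈ G.edges, μ.real {ω | x e ω = -∏ i ∈ e, y i} = p
  edge_indep : iIndepFun (fun (e : {e // e ∈ G.edges}) ↦ x e) μ
  node_measurable : ∀ i, Measurable (z i)
  node_correct : ∀ i, μ.real {ω | z i ω = y i} = 1 - q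
  node_flipped : ∀ i, μ.real {ω | z i ω = -y i} = q
  node_indep : iIndepFun z μ

/-! ### The two-stage approach -/

/-- The inner product of two tensors. -/
def tensorInner {n m : ℕ} (A B : Tensor n m) : ℝ := ∑ i, A i * B i

/-- The `m`-fold outer power of the vector `v`. -/
def outerPower {n : ℕ} (m : ℕ) (v : Fin n → ℝ) : Tensor n m := fun i ↦ ∏ j, v (i j)

/-- The Caratheodory tensor cone: sums of `(m + n - 1).choose m` outer powers. -/
def caratheodoryCone (n m : ℕ) : Set (Tensor n m) :=
  {Y | ∃ v : Fin ((m + n - 1).choose m) → Fin n → ℝ, Y = ∑ k, outerPower m (v k)}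

/-- The index tuples in which every index occurs an even number of times. -/
def evenTuples (n m : ℕ) : Set (Fin m → Fin n) :=
  {i | ∀ a, Even (Finset.univ.filter fun j ↦ i j = a).card}

/-- The index tuples with a repeated index that are not in `evenTuples`. -/
def oddTuples (n m : ℕ) : Set (Fin m → Fin n) :=
  {i | i ∉ evenTuples n m ∧ ¬ Function.Injective i}

/-- The feasible set of the convex program of stage one. -/
def stageOneFeasible (n m : ℕ) : Set (Tensor n m) :=
  {Y | Y ∈ caratheodoryCone n m ∧ (∀ i ∈ oddTuples n m, -1 ≤ Y i ∧ Y i ≤ 1) ∧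
    ∀ i ∈ evenTuples n m, Y i = 1}

/-- `Y` is an optimal solution of the convex program of stage one: it maximizes `⟨X, Y⟩` over the
feasible set. -/
def IsStageOneSolution {n m : ℕ} (X Y : Tensor n m) : Prop :=
  Y ∈ stageOneFeasible n m ∧ IsMaxOn (tensorInner X) (stageOneFeasible n m) Y

/-- The labelings obtained by factoring `Y` as an outer power. -/
def factors {n m : ℕ} (Y : Tensor n m) : Set (Fin n → ℝ) :=
  {w | IsLabeling w ∧ outerPower m w = Y}

/-- `w` is an output of stage two: among the factors of the tensor `Y` found in stage one, it
maximizes the correlation with the node observation `z`. -/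
def IsStageTwoSolution {n m : ℕ} (z : Fin n → ℝ) (Y : Tensor n m) (w : Fin n → ℝ) : Prop :=
  w ∈ factors Y ∧ IsMaxOn (fun w' ↦ z ⬝ᵥ w') (factors Y) w

/-- The two-stage approach infers `y` exactly from `X` and `z`: the rank-one tensor of `y` is the
unique optimal solution in stage one, and `y` is then the unique output of stage two. -/
def ExactInference {n m : ℕ} (X : Tensor n m) (z y : Fin n → ℝ) : Prop :=
  (∀ Y, IsStageOneSolution X Y ↔ Y = outerPower m y) ∧
    ∀ w, IsStageTwoSolution z (outerPower m y) w ↔ w = y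

end HypergraphInference

end

namespace HypergraphInference

/-! ### Labelings and outer powers -/

/-! For even `m ≥ 6` the stage-one relaxation is tight. The diagonal constraints force all
coordinates of each vector in a feasible decomposition to have the same absolute value, so every
feasible tensor is a convex combination of outer powers of labelings
(`exists_convex_combination_of_mem_stageOneFeasible`). Stage one thus compares `y` with labelings
`w` only. If `w` differs from `y` exactly on `W`, the objective drops by a positive multiple of the
sum of the unflipped-minus-flipped signs over the hyperedges meeting `W` oddly (`sum_edges_sub_eq`).

Those hyperedges include the boundary of the hypervertices meeting `W` oddly, so expansion gives at
least `c * d` of them. A Chernoff bound per `W` and a union bound over at most `2 ^ n` sets leave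
failure probability `2 ^ n * b ^ (c * d)` with `b < 1`, which vanishes because `n = o(d)`. Stage two
only chooses between `y` and `-y`, and a second Chernoff bound settles it.

The case `m = 2` is void for large `n`: a graph satisfies `c * d ≤ n`, contradicting the growth of
`d`. -/

lemma IsLabeling.mul_self {n : ℕ} {w : Fin n → ℝ} (hw : IsLabeling w) (i : Fin n) :
    w i * w i = 1 := by
  rcases hw i with h | h <;> simp [h]

lemma IsLabeling.abs_eq {n : ℕ} {w : Fin n → ℝ} (hw : IsLabeling w) (i : Fin n) :
    |w i| = 1 := by
  rcases hw i with h | h <;> simp [h]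

lemma IsLabeling.prod_eq {n : ℕ} {w : Fin n → ℝ} (hw : IsLabeling w) (e : Finset (Fin n)) :
    ∏ i ∈ e, w i = 1 ∨ ∏ i ∈ e, w i = -1 := by
  have h : |∏ i ∈ e, w i| = 1 := by
    rw [Finset.abs_prod]
    exact Finset.prod_eq_one fun i _ ↦ hw.abs_eq i
  exact eq_or_eq_neg_of_abs_eq h

lemma outerPower_neg {n m : ℕ} (hm : Even m) (w : Fin n → ℝ) :
    outerPower m (-w) = outerPower m w := by
  ext i
  simp [outerPower, Finset.prod_neg, hm.neg_one_pow]

lemma outerPower_smul {n : ℕ} (m : ℕ) (l : ℝ) (w : Fin n → ℝ) :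
    outerPower m (l • w) = l ^ m • outerPower m w := by
  ext i
  simp [outerPower, Finset.prod_mul_distrib]

/-- The index tuple whose first `r` entries are `b` and whose other entries are `a`. -/
def stepTuple {n : ℕ} (m r : ℕ) (a b : Fin n) : Fin m → Fin n :=
  fun j ↦ if (j : ℕ) < r then b else a

lemma card_filter_lt {m r : ℕ} (hr : r ≤ m) :
    (Finset.univ.filter fun j : Fin m ↦ (j : ℕ) < r).card = r := by
  rw [Fin.card_filter_val_lt, min_eq_right hr]

lemma card_filter_not_lt {m r : ℕ} (hr : r ≤ m) :
    (Finset.univ.filter fun j : Fin m ↦ ¬ (j : ℕ) < r).card = m - r := by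
  have h := Finset.card_filter_add_card_filter_not (s := (Finset.univ : Finset (Fin m)))
    (fun j ↦ (j : ℕ) < r)
  rw [card_filter_lt hr, Finset.card_univ, Fintype.card_fin] at h
  omega

lemma outerPower_stepTuple {n m r : ℕ} (hr : r ≤ m) (v : Fin n → ℝ) (a b : Fin n) :
    outerPower m v (stepTuple m r a b) = v b ^ r * v a ^ (m - r) := by
  simp only [outerPower, stepTuple, apply_ite v]
  rw [Finset.prod_ite, Finset.prod_const, Finset.prod_const, card_filter_lt hr,
    card_filter_not_lt hr]

lemma stepTuple_mem_evenTuples {n m r : ℕ} (hr : r ≤ m) (hm : Even m) (hre : Even r)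
    (a b : Fin n) : stepTuple m r a b ∈ evenTuples n m := by
  intro x
  have hmr : Even (m - r) := hm.tsub hre
  by_cases hb : b = x <;> by_cases ha : a = x
  · simpa [stepTuple, hb, ha] using hm
  · have h : (Finset.univ.filter fun j : Fin m ↦ stepTuple m r a b j = x)
        = Finset.univ.filter fun j : Fin m ↦ (j : ℕ) < r := by
      ext j; by_cases hj : (j : ℕ) < r <;> simp [stepTuple, ha, hb]
    rwa [h, card_filter_lt hr]
  · have h : (Finset.univ.filter fun j : Fin m ↦ stepTuple m r a b j = x)
        = Finset.univ.filter fun j : Fin m ↦ ¬ (j : ℕ) < r := by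
      ext j; by_cases hj : (j : ℕ) < r <;> simp [stepTuple, ha, hb]
    rwa [h, card_filter_not_lt hr]
  · have h : (Finset.univ.filter fun j : Fin m ↦ stepTuple m r a b j = x) = ∅ := by
      refine Finset.filter_eq_empty_iff.mpr fun j _ ↦ ?_
      by_cases hj : (j : ℕ) < r
      · simpa [stepTuple, hj] using hb
      · simpa [stepTuple, hj] using ha
    simp [h]

/-- Two labelings with the same outer power of even order agree up to a global sign. -/
lemma eq_or_eq_neg_of_outerPower_eq {n m : ℕ} (hm : Even m) (hm0 : m ≠ 0) {w y : Fin n → ℝ}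
    (hw : IsLabeling w) (hy : IsLabeling y) (h : outerPower m w = outerPower m y) :
    w = y ∨ w = -y := by
  obtain ⟨k, rfl⟩ : ∃ k, m = 2 * k + 1 + 1 := by
    obtain ⟨k, hk⟩ := hm
    exact ⟨k - 1, by omega⟩
  -- The exponent `m - 1` is odd, so squares cancel and these entries read off the pairwise
  -- products, which determine a labeling up to sign.
  have key : ∀ {v : Fin n → ℝ}, IsLabeling v → ∀ a b,
      outerPower (2 * k + 1 + 1) v (stepTuple _ 1 a b) = v b * v a := by
    intro v hv a b
    rw [outerPower_stepTuple (by omega)]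
    simp [pow_succ, pow_mul, hv.mul_self]
  have hab : ∀ a b, w b * w a = y b * y a := fun a b ↦ by
    rw [← key hw, ← key hy, h]
  rcases isEmpty_or_nonempty (Fin n) with hn | ⟨⟨a⟩⟩
  · exact Or.inl (Subsingleton.elim _ _)
  rcases hw a with h1 | h1 <;> rcases hy a with h2 | h2
  · left; ext b; simpa [h1, h2] using hab a b
  · right; ext b; simpa [h1, h2] using hab a b
  · right; ext b; have := hab a b; simp [h1, h2] at this; simp; linarith
  · left; ext b; simpa [h1, h2] using hab a b

lemma outerPower_mem_stageOneFeasible {n m : ℕ} (hn : n ≠ 0) (hm0 : m ≠ 0) {y : Fin n → ℝ}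
    (hy : IsLabeling y) : outerPower m y ∈ stageOneFeasible n m := by
  refine ⟨?_, fun i _ ↦ ?_, fun i hi ↦ ?_⟩
  · have hpos : 0 < (m + n - 1).choose m := Nat.choose_pos (by omega)
    refine ⟨fun k ↦ if k = ⟨0, hpos⟩ then y else 0, ?_⟩
    rw [Finset.sum_eq_single ⟨0, hpos⟩]
    · simp
    · intro k _ hk
      ext i
      simp [hk, outerPower, hm0]
    · simp
  · have h : |outerPower m y i| = 1 := by
      rw [outerPower, Finset.abs_prod]
      exact Finset.prod_eq_one fun j _ ↦ hy.abs_eq _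
    exact abs_le.mp h.le
  · rw [outerPower, Finset.prod_comp]
    refine Finset.prod_eq_one fun a _ ↦ ?_
    rcases hy a with h | h
    · simp [h]
    · rw [h]; exact (hi a).neg_one_pow

/-- For even order at least six the constraints of stage one force every summand of a feasible
tensor to be a nonnegative multiple of the outer power of a labeling. -/
lemma exists_convex_combination_of_mem_stageOneFeasible {n m : ℕ} (hn : n ≠ 0) (hm : Even m)
    (hm6 : 6 ≤ m) {Y : Tensor n m} (hY : Y ∈ stageOneFeasible n m) :
    ∃ (K : ℕ) (l : Fin K → ℝ) (w : Fin K → Fin n → ℝ), (∀ k, 0 ≤ l k) ∧ ∑ k, l k = 1 ∧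
      (∀ k, IsLabeling (w k)) ∧ Y = ∑ k, l k • outerPower m (w k) := by
  obtain ⟨⟨v, hv⟩, -, heven⟩ := hY
  have hsum : ∀ {r : ℕ}, r ≤ m → Even r → ∀ a b, ∑ k, v k b ^ r * v k a ^ (m - r) = 1 := by
    intro r hr hre a b
    have h := heven _ (stepTuple_mem_evenTuples hr hm hre a b)
    rw [hv, Finset.sum_apply] at h
    simpa only [outerPower_stepTuple hr] using h
  have hm4 : Even (m - 4) := hm.tsub (by decide)
  have hzero : ∀ a b k, v k a ^ (m - 4) * (v k a ^ 2 - v k b ^ 2) ^ 2 = 0 := by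
    intro a b
    have h0 := hsum (r := 0) (by omega) (by decide) a b
    have h2 := hsum (r := 2) (by omega) (by decide) a b
    have h4 := hsum (r := 4) (by omega) (by decide) a b
    -- Expanding the square combines the constraints for `r = 0, 2, 4` into `1 - 2 + 1 = 0`; the
    -- summands are nonnegative since `m - 4` is even.
    have hs : ∑ k, v k a ^ (m - 4) * (v k a ^ 2 - v k b ^ 2) ^ 2 = 0 := by
      have : ∀ k, v k a ^ (m - 4) * (v k a ^ 2 - v k b ^ 2) ^ 2 =
          v k b ^ 0 * v k a ^ (m - 0) - 2 * (v k b ^ 2 * v k a ^ (m - 2))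
            + v k b ^ 4 * v k a ^ (m - 4) := by
        intro k
        obtain ⟨t, rfl⟩ : ∃ t, m = t + 4 := ⟨m - 4, by omega⟩
        have e1 : t + 4 - 4 = t := by omega
        have e2 : t + 4 - 2 = t + 2 := by omega
        rw [e1, e2, Nat.sub_zero]
        ring
      simp_rw [this]
      rw [Finset.sum_add_distrib, Finset.sum_sub_distrib, ← Finset.mul_sum, h0, h2, h4]
      norm_num
    intro k
    exact (Finset.sum_eq_zero_iff_of_nonneg
      (fun k _ ↦ mul_nonneg (hm4.pow_nonneg _) (sq_nonneg _))).mp hs k (Finset.mem_univ k)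
  have habs : ∀ k a b, v k a ≠ 0 → |v k b| = |v k a| := by
    intro k a b ha
    have h : v k a ^ 2 - v k b ^ 2 = 0 := by
      simpa [ha] using hzero a b k
    exact ((sq_eq_sq_iff_abs_eq_abs _ _).mp (by linarith)).symm
  let a₀ : Fin n := ⟨0, Nat.pos_of_ne_zero hn⟩
  -- A zero at `a₀` forces `v k = 0`, since a nonzero coordinate would have the same absolute value
  -- as the one at `a₀`.
  have habs' : ∀ k b, |v k b| = |v k a₀| := by
    intro k b
    by_cases h0 : v k a₀ = 0
    · by_cases hb : v k b = 0
      · rw [h0, hb]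
      · exact (habs k b a₀ hb).symm
    · exact habs k a₀ b h0
  have hfac : ∀ k, v k = |v k a₀| • fun b ↦ if v k b < 0 then (-1 : ℝ) else 1 := by
    intro k
    ext b
    simp only [Pi.smul_apply, smul_eq_mul, ← habs' k b]
    split_ifs with hb
    · rw [abs_of_neg hb]; ring
    · rw [abs_of_nonneg (not_lt.mp hb), mul_one]
  refine ⟨_, fun k ↦ |v k a₀| ^ m, fun k b ↦ if v k b < 0 then (-1 : ℝ) else 1,
    fun k ↦ by positivity, ?_, fun k b ↦ ?_, ?_⟩
  · have h := hsum (r := 0) (by omega) (by decide) a₀ a₀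
    simpa [hm.pow_abs] using h
  · by_cases hb : v k b < 0 <;> simp [hb]
  · rw [hv]
    refine Finset.sum_congr rfl fun k _ ↦ ?_
    rw [← outerPower_smul, ← hfac]

/-! ### The objective of stage one -/

/-- A tuple of length `m` with image `e` is a bijection `Fin m ≃ e`. -/
lemma card_filter_image_eq {n m : ℕ} {e : Finset (Fin n)} (he : e.card = m) :
    (Finset.univ.filter fun i : Fin m → Fin n ↦ Finset.univ.image i = e).card
      = m.factorial := by
  classical
  have hbij : ∀ i : Fin m → Fin n, Finset.univ.image i = e → Function.Injective i := by
    intro i hi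
    rw [← Set.injOn_univ, ← Finset.coe_univ, ← Finset.card_image_iff, hi, he]
    simp
  have hcard : Fintype.card (Fin m) = Fintype.card e := by simp [he]
  have hfact : m.factorial = Fintype.card (Fin m ≃ e) := by
    rw [Fintype.card_equiv (Fintype.equivOfCardEq hcard), Fintype.card_fin]
  rw [← Fintype.card_subtype, hfact]
  refine Fintype.card_congr
    { toFun := fun i ↦ Equiv.ofBijective
        (fun j ↦ ⟨i.1 j, i.2.subset (Finset.mem_image_of_mem _ (Finset.mem_univ j))⟩) ?_
      invFun := fun f ↦ ⟨fun j ↦ (f j : Fin n), ?_⟩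
      left_inv := fun i ↦ rfl
      right_inv := fun f ↦ by ext j; rfl }
  · rw [Fintype.bijective_iff_injective_and_card]
    exact ⟨fun a b hab ↦ hbij i.1 i.2 (congrArg Subtype.val hab), hcard⟩
  · ext a
    simp only [Finset.mem_image, Finset.mem_univ, true_and]
    exact ⟨fun ⟨j, hj⟩ ↦ hj ▸ (f j).2, fun ha ↦ ⟨f.symm ⟨a, ha⟩, by simp⟩⟩

lemma outerPower_apply_of_image_eq {n m : ℕ} {e : Finset (Fin n)} (he : e.card = m)
    (w : Fin n → ℝ) {i : Fin m → Fin n} (hi : Finset.univ.image i = e) :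
    outerPower m w i = ∏ a ∈ e, w a := by
  have hinj : Set.InjOn i (Finset.univ : Finset (Fin m)) := by
    rw [← Finset.card_image_iff, hi, he]
    simp
  rw [outerPower, ← hi, Finset.prod_image hinj]

lemma tensorInner_observationTensor_outerPower {n m : ℕ} (G : UniformHypergraph n m)
    (x : Finset (Fin n) → ℝ) (w : Fin n → ℝ) :
    tensorInner (observationTensor G x) (outerPower m w)
      = m.factorial * ∑ e ∈ G.edges, x e * ∏ a ∈ e, w a := by
  classical
  have h1 : tensorInner (observationTensor G x) (outerPower m w)
      = ∑ i ∈ Finset.univ.filter (fun i : Fin m → Fin n ↦ Finset.univ.image i ∈ G.edges),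
        x (Finset.univ.image i) * outerPower m w i := by
    rw [Finset.sum_filter, tensorInner]
    refine Finset.sum_congr rfl fun i _ ↦ ?_
    simp only [observationTensor, ite_mul, zero_mul]
  rw [h1, ← Finset.sum_fiberwise_of_maps_to (g := fun i ↦ Finset.univ.image i)
    (t := G.edges) (by simp), Finset.mul_sum]
  refine Finset.sum_congr rfl fun e he ↦ ?_
  have hcard : e.card = m := G.sized he
  rw [Finset.filter_filter, ← card_filter_image_eq hcard]
  have hfil : (Finset.univ.filter fun i : Fin m → Fin n ↦
      Finset.univ.image i ∈ G.edges ∧ Finset.univ.image i = e)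
      = Finset.univ.filter fun i : Fin m → Fin n ↦ Finset.univ.image i = e := by
    ext i
    simp only [Finset.mem_filter, Finset.mem_univ, true_and, and_iff_right_iff_imp]
    rintro rfl
    exact he
  rw [hfil, ← nsmul_eq_mul]
  refine Finset.sum_eq_card_nsmul fun i hi ↦ ?_
  have hi' := (Finset.mem_filter.mp hi).2
  rw [hi', outerPower_apply_of_image_eq hcard w hi']

lemma tensorInner_sum_smul {n m K : ℕ} (X : Tensor n m) (l : Fin K → ℝ)
    (T : Fin K → Tensor n m) :
    tensorInner X (∑ k, l k • T k) = ∑ k, l k * tensorInner X (T k) := by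
  simp only [tensorInner, Finset.sum_apply, Pi.smul_apply, smul_eq_mul, Finset.mul_sum]
  rw [Finset.sum_comm]
  exact Finset.sum_congr rfl fun k _ ↦ Finset.sum_congr rfl fun i _ ↦ by ring

/-- Stage one recovers the outer power of `y` when `y` and `-y` are the only maximizers of the
objective among labelings. -/
lemma isStageOneSolution_iff {n m : ℕ} (hn : n ≠ 0) (hm : Even m) (hm6 : 6 ≤ m)
    {X : Tensor n m} {y : Fin n → ℝ} (hy : IsLabeling y)
    (hX : ∀ w, IsLabeling w → w ≠ y → w ≠ -y →
      tensorInner X (outerPower m w) < tensorInner X (outerPower m y)) (Y : Tensor n m) :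
    IsStageOneSolution X Y ↔ Y = outerPower m y := by
  have hle : ∀ w, IsLabeling w →
      tensorInner X (outerPower m w) ≤ tensorInner X (outerPower m y) := by
    intro w hw
    by_cases h1 : w = y
    · rw [h1]
    by_cases h2 : w = -y
    · rw [h2, outerPower_neg hm]
    exact (hX w hw h1 h2).le
  have hfeas := outerPower_mem_stageOneFeasible hn (by omega : m ≠ 0) hy
  constructor
  · rintro ⟨hY, hmax⟩
    obtain ⟨K, l, w, hl, hl1, hw, rfl⟩ :=
      exists_convex_combination_of_mem_stageOneFeasible hn hm hm6 hY
    have hge : tensorInner X (outerPower m y) ≤ tensorInner X (∑ k, l k • outerPower m (w k)) :=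
      hmax hfeas
    rw [tensorInner_sum_smul] at hge
    -- Nonnegative gaps with weighted sum zero: every summand of positive weight comes from `y` or
    -- `-y`, and these have the same outer power.
    have hterm : ∀ k ∈ Finset.univ, 0 ≤
        l k * (tensorInner X (outerPower m y) - tensorInner X (outerPower m (w k))) :=
      fun k _ ↦ mul_nonneg (hl k) (sub_nonneg.mpr (hle _ (hw k)))
    have hsum : ∑ k, l k *
        (tensorInner X (outerPower m y) - tensorInner X (outerPower m (w k))) = 0 := by
      refine le_antisymm ?_ (Finset.sum_nonneg hterm)
      simp only [mul_sub, Finset.sum_sub_distrib, ← Finset.sum_mul, hl1, one_mul]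
      linarith
    have hk := (Finset.sum_eq_zero_iff_of_nonneg hterm).mp hsum
    have hEq : ∀ k, l k • outerPower m (w k) = l k • outerPower m y := by
      intro k
      rcases mul_eq_zero.mp (hk k (Finset.mem_univ k)) with h | h
      · simp [h]
      · by_cases h1 : w k = y
        · rw [h1]
        by_cases h2 : w k = -y
        · rw [h2, outerPower_neg hm]
        have := hX _ (hw k) h1 h2
        linarith
    rw [Finset.sum_congr rfl fun k _ ↦ hEq k, ← Finset.sum_smul, hl1, one_smul]
  · rintro rfl
    refine ⟨hfeas, fun Y hY ↦ ?_⟩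
    obtain ⟨K, l, w, hl, hl1, hw, rfl⟩ :=
      exists_convex_combination_of_mem_stageOneFeasible hn hm hm6 hY
    change tensorInner X (∑ k, l k • outerPower m (w k)) ≤ _
    rw [tensorInner_sum_smul]
    calc ∑ k, l k * tensorInner X (outerPower m (w k))
        ≤ ∑ k, l k * tensorInner X (outerPower m y) :=
          Finset.sum_le_sum fun k _ ↦ mul_le_mul_of_nonneg_left (hle _ (hw k)) (hl k)
      _ = tensorInner X (outerPower m y) := by rw [← Finset.sum_mul, hl1, one_mul]

lemma isStageTwoSolution_iff {n m : ℕ} (hm : Even m) (hm0 : m ≠ 0) {z y : Fin n → ℝ}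
    (hy : IsLabeling y) (hz : 0 < z ⬝ᵥ y) (w : Fin n → ℝ) :
    IsStageTwoSolution z (outerPower m y) w ↔ w = y := by
  have hymem : y ∈ factors (outerPower m y) := ⟨hy, rfl⟩
  constructor
  · rintro ⟨⟨hw, hwy⟩, hmax⟩
    rcases eq_or_eq_neg_of_outerPower_eq hm hm0 hw hy hwy with h | h
    · exact h
    · have : z ⬝ᵥ y ≤ z ⬝ᵥ w := hmax hymem
      rw [h, dotProduct_neg] at this
      linarith
  · rintro rfl
    refine ⟨hymem, fun v hv ↦ ?_⟩
    change z ⬝ᵥ v ≤ z ⬝ᵥ w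
    rcases eq_or_eq_neg_of_outerPower_eq hm hm0 hv.1 hy hv.2 with h | h
    · rw [h]
    · rw [h, dotProduct_neg]
      linarith

/-! ### A Chernoff bound for flipped signs -/

section Chernoff

variable {Ω : Type*} [MeasurableSpace Ω] {μ : Measure Ω} [IsProbabilityMeasure μ]

/-- The Chernoff base of signs flipped with probability `p`. -/
noncomputable def chernoffBase (p : ℝ) : ℝ := 1 / 2 + 2 * p * (1 - p)

lemma chernoffBase_pos {p : ℝ} (hp₀ : 0 ≤ p) (hp : p < 1 / 2) : 0 < chernoffBase p := by
  have : 0 ≤ p * (1 - p) := mul_nonneg hp₀ (by linarith)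
  unfold chernoffBase
  linarith

lemma chernoffBase_lt_one {p : ℝ} (hp : p < 1 / 2) : chernoffBase p < 1 := by
  have : 0 < (1 - 2 * p) ^ 2 := pow_pos (by linarith) 2
  unfold chernoffBase
  nlinarith

/-- The two values carry total mass `(1 - p) + p = 1`, so no other value matters. -/
lemma exp_mul_ae_eq_indicator {p : ℝ} {ξ : Ω → ℝ} (hξ : Measurable ξ)
    (h1 : μ.real {ω | ξ ω = 1} = 1 - p) (h2 : μ.real {ω | ξ ω = -1} = p) (t : ℝ) :
    (fun ω ↦ Real.exp (t * ξ ω)) =ᵐ[μ] fun ω ↦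
      {ω | ξ ω = 1}.indicator (fun _ ↦ Real.exp t) ω
        + {ω | ξ ω = -1}.indicator (fun _ ↦ Real.exp (-t)) ω := by
  have hm1 : MeasurableSet {ω | ξ ω = 1} := hξ (measurableSet_singleton 1)
  have hm2 : MeasurableSet {ω | ξ ω = -1} := hξ (measurableSet_singleton (-1))
  have hdisj : Disjoint {ω | ξ ω = 1} {ω | ξ ω = -1} := by
    rw [Set.disjoint_left]
    intro ω h h'
    simp only [Set.mem_ofPred_eq] at h h'
    linarith
  have hfull : μ.real ({ω | ξ ω = 1} ∪ {ω | ξ ω = -1}) = 1 := by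
    rw [measureReal_union hdisj hm2, h1, h2]
    ring
  have hae : ∀ᵐ ω ∂μ, ω ∈ {ω | ξ ω = 1} ∪ {ω | ξ ω = -1} := by
    rw [measureReal_def] at hfull
    exact (mem_ae_iff_prob_eq_one₀ (hm1.union hm2).nullMeasurableSet).mpr
      ((ENNReal.toReal_eq_one_iff _).mp hfull)
  filter_upwards [hae] with ω hω
  rcases hω with h | h
  · have h' : ξ ω = 1 := h
    norm_num [Set.indicator, h']
  · have h' : ξ ω = -1 := h
    norm_num [Set.indicator, h']

lemma integrable_exp_mul_of_sign {p : ℝ} {ξ : Ω → ℝ} (hξ : Measurable ξ)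
    (h1 : μ.real {ω | ξ ω = 1} = 1 - p) (h2 : μ.real {ω | ξ ω = -1} = p) (t : ℝ) :
    Integrable (fun ω ↦ Real.exp (t * ξ ω)) μ := by
  rw [integrable_congr (exp_mul_ae_eq_indicator hξ h1 h2 t)]
  exact ((integrable_const _).indicator (hξ (measurableSet_singleton 1))).add
    ((integrable_const _).indicator (hξ (measurableSet_singleton (-1))))

lemma mgf_of_sign {p : ℝ} {ξ : Ω → ℝ} (hξ : Measurable ξ)
    (h1 : μ.real {ω | ξ ω = 1} = 1 - p) (h2 : μ.real {ω | ξ ω = -1} = p) (t : ℝ) :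
    mgf ξ μ t = (1 - p) * Real.exp t + p * Real.exp (-t) := by
  have hm1 : MeasurableSet {ω | ξ ω = 1} := hξ (measurableSet_singleton 1)
  have hm2 : MeasurableSet {ω | ξ ω = -1} := hξ (measurableSet_singleton (-1))
  rw [mgf, integral_congr_ae (exp_mul_ae_eq_indicator hξ h1 h2 t), integral_add
    ((integrable_const _).indicator hm1) ((integrable_const _).indicator hm2),
    integral_indicator_const _ hm1, integral_indicator_const _ hm2, h1, h2]
  simp

lemma measureReal_sum_sign_nonpos_le {ι : Type*} {p : ℝ} (hp : p < 1 / 2)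
    {ξ : ι → Ω → ℝ} {σ : ι → ℝ} (hσ : ∀ i, σ i = 1 ∨ σ i = -1) (hξ : ∀ i, Measurable (ξ i))
    (hind : iIndepFun ξ μ) (h1 : ∀ i, μ.real {ω | ξ i ω = σ i} = 1 - p)
    (h2 : ∀ i, μ.real {ω | ξ i ω = -σ i} = p) (s : Finset ι) :
    μ.real {ω | ∑ i ∈ s, ξ i ω * σ i ≤ 0} ≤ chernoffBase p ^ s.card := by
  let ζ : ι → Ω → ℝ := fun i ω ↦ ξ i ω * σ i
  have hζm : ∀ i, Measurable (ζ i) := fun i ↦ (hξ i).mul_const _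
  have hζind : iIndepFun ζ μ := hind.comp (fun i u ↦ u * σ i) fun i ↦ measurable_id.mul_const _
  have hζ1 : ∀ i, μ.real {ω | ζ i ω = 1} = 1 - p := by
    intro i
    rw [← h1 i]
    congr 1
    ext ω
    rcases hσ i with h | h <;> simp only [Set.mem_ofPred_eq, ζ, h] <;>
      constructor <;> intro h <;> linarith
  have hζ2 : ∀ i, μ.real {ω | ζ i ω = -1} = p := by
    intro i
    rw [← h2 i]
    congr 1
    ext ω
    rcases hσ i with h | h <;> simp only [Set.mem_ofPred_eq, ζ, h] <;>
      constructor <;> intro h <;> linarith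
  have hpos : 0 < 2 - 2 * p := by linarith
  have hne : 1 - p ≠ 0 := by linarith
  -- This `t` gives `(1 - p) / (2 - 2p) + p (2 - 2p) = 1/2 + 2p(1 - p)`. The optimal tilt `log (p /
  -- (1 - p)) / 2` would degenerate at `p = 0`; this one stays finite.
  let t : ℝ := -Real.log (2 - 2 * p)
  have ht : t ≤ 0 := neg_nonpos.mpr (Real.log_nonneg (by linarith))
  have hmgf : ∀ i, mgf (ζ i) μ t = chernoffBase p := by
    intro i
    rw [mgf_of_sign (hζm i) (hζ1 i) (hζ2 i)]
    simp only [t, neg_neg, Real.exp_neg, Real.exp_log hpos, chernoffBase]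
    field_simp
  have hint := hζind.integrable_exp_mul_sum (t := t) hζm (s := s) fun i _ ↦
    integrable_exp_mul_of_sign (hζm i) (hζ1 i) (hζ2 i) t
  have h := measure_le_le_exp_mul_mgf (X := ∑ i ∈ s, ζ i) 0 ht hint
  rw [hζind.mgf_sum hζm, Finset.prod_congr rfl fun i _ ↦ hmgf i, Finset.prod_const] at h
  simpa [ζ] using h

end Chernoff

/-! ### Expansion -/

/-- The hyperedges that meet `W` in an odd number of vertices. -/
def oddEdges {n m : ℕ} (G : UniformHypergraph n m) (W : Finset (Fin n)) :
    Finset (Finset (Fin n)) :=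
  {e ∈ G.edges | Odd (e ∩ W).card}

lemma boundary_hypervertices_sdiff {n m : ℕ} (G : UniformHypergraph n m)
    {S : Finset (Finset (Fin n))} (hS : S ⊆ hypervertices n m) :
    boundary G (hypervertices n m \ S) = boundary G S := by
  ext e
  simp only [boundary, Finset.mem_filter, Finset.sdiff_sdiff_eq_self hS]
  refine and_congr_right fun _ ↦ ⟨?_, ?_⟩ <;>
    exact fun ⟨h₁, m₁, h₂, m₂, hd, he⟩ ↦
      ⟨h₂, m₂, h₁, m₁, hd.symm, he.trans (Finset.union_comm _ _)⟩

/-- An expander has many boundary hyperedges for every nontrivial set of hypervertices. -/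
lemma IsRegularExpander.mul_le_card_boundary {n m d : ℕ} {c : ℝ} {G : UniformHypergraph n m}
    (hG : IsRegularExpander G d c) (hc : 0 ≤ c) {S : Finset (Finset (Fin n))}
    (hS : S ⊆ hypervertices n m) (h1 : S.Nonempty) (h2 : (hypervertices n m \ S).Nonempty) :
    c * d ≤ ((boundary G S).card : ℝ) := by
  have key : ∀ T ⊆ hypervertices n m, T.Nonempty →
      (T.card : ℝ) ≤ ((hypervertices n m).card : ℝ) / 2 → c * d ≤ ((boundary G T).card : ℝ) := by
    intro T hT hne hcard
    refine le_trans ?_ (hG T hT hne.card_pos hcard)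
    have : (1 : ℝ) ≤ T.card := by exact_mod_cast hne.card_pos
    exact le_mul_of_one_le_right (by positivity) this
  rcases le_total (S.card : ℝ) ((hypervertices n m).card / 2) with h | h
  · exact key S hS h1 h
  · rw [← boundary_hypervertices_sdiff G hS]
    refine key _ Finset.sdiff_subset h2 ?_
    rw [Finset.cast_card_sdiff hS]
    linarith

/-- A boundary hyperedge joins disjoint halves of which exactly one meets `W` oddly, and odd plus
even is odd. -/
lemma boundary_filter_odd_subset_oddEdges {n m : ℕ} (G : UniformHypergraph n m)
    (W : Finset (Fin n)) :
    boundary G ((hypervertices n m).filter fun h ↦ Odd (h ∩ W).card) ⊆ oddEdges G W := by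
  intro e he
  simp only [boundary, Finset.mem_filter, Finset.mem_sdiff, not_and] at he
  obtain ⟨heG, h₁, ⟨-, hodd⟩, h₂, ⟨hm₂, heven⟩, hd, rfl⟩ := he
  refine Finset.mem_filter.mpr ⟨heG, ?_⟩
  rw [Finset.union_inter_distrib_right, Finset.card_union_of_disjoint
    (hd.mono Finset.inter_subset_left Finset.inter_subset_left)]
  exact hodd.add_even (Nat.not_odd_iff_even.mp (heven hm₂))

/-- Exchanging a vertex of `W` for one outside `W` changes the parity of the intersection. -/
lemma exists_hypervertices_parity {n m : ℕ} (hm : 2 ≤ m) (hn : m / 2 + 1 ≤ n)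
    {W : Finset (Fin n)} (hW : W.Nonempty) (hW' : W ≠ Finset.univ) :
    (∃ h ∈ hypervertices n m, Odd (h ∩ W).card) ∧
      ∃ h ∈ hypervertices n m, ¬ Odd (h ∩ W).card := by
  obtain ⟨a, ha⟩ := hW
  obtain ⟨b, hb⟩ : ∃ b, b ∉ W := by
    by_contra! h
    exact hW' (Finset.eq_univ_iff_forall.mpr h)
  have hab : a ≠ b := fun h ↦ hb (h ▸ ha)
  -- Room for `T` outside `{a, b}` needs `m / 2 - 1 ≤ n - 2`, which is where `m / 2 + 1 ≤ n` enters.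
  obtain ⟨T, hT, hTc⟩ : ∃ T ⊆ (Finset.univ \ {a, b} : Finset (Fin n)), T.card = m / 2 - 1 := by
    apply Finset.exists_subset_card_eq
    rw [Finset.card_sdiff_of_subset (Finset.subset_univ _), Finset.card_pair hab]
    simp
    omega
  have haT : a ∉ T := fun h ↦ by simpa using hT h
  have hbT : b ∉ T := fun h ↦ by simpa using hT h
  have hA : insert a T ∈ hypervertices n m := by
    simp only [hypervertices, Finset.mem_powersetCard, Finset.subset_univ, true_and,
      Finset.card_insert_of_notMem haT]
    omega
  have hB : insert b T ∈ hypervertices n m := by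
    simp only [hypervertices, Finset.mem_powersetCard, Finset.subset_univ, true_and,
      Finset.card_insert_of_notMem hbT]
    omega
  have hAc : (insert a T ∩ W).card = (T ∩ W).card + 1 := by
    rw [Finset.insert_inter_of_mem ha, Finset.card_insert_of_notMem (by simp [haT])]
  have hBc : (insert b T ∩ W).card = (T ∩ W).card := by
    rw [Finset.insert_inter_of_notMem hb]
  by_cases hp : Odd (T ∩ W).card
  · exact ⟨⟨_, hB, by rwa [hBc]⟩, ⟨_, hA, by rw [hAc]; simpa using hp.add_odd odd_one⟩⟩
  · exact ⟨⟨_, hA, by rw [hAc]; exact (Nat.not_odd_iff_even.mp hp).add_one⟩,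
      ⟨_, hB, by rwa [hBc]⟩⟩

lemma IsRegularExpander.mul_le_card_oddEdges {n m d : ℕ} {c : ℝ} {G : UniformHypergraph n m}
    (hG : IsRegularExpander G d c) (hc : 0 ≤ c) (hm : 2 ≤ m) (hn : m / 2 + 1 ≤ n)
    {W : Finset (Fin n)} (hW : W.Nonempty) (hW' : W ≠ Finset.univ) :
    c * d ≤ ((oddEdges G W).card : ℝ) := by
  obtain ⟨⟨h₁, m₁, p₁⟩, ⟨h₂, m₂, p₂⟩⟩ := exists_hypervertices_parity hm hn hW hW'
  refine (hG.mul_le_card_boundary hc (Finset.filter_subset (fun h ↦ Odd (h ∩ W).card) _)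
    ⟨h₁, Finset.mem_filter.mpr ⟨m₁, p₁⟩⟩ ⟨h₂, ?_⟩).trans ?_
  · simp [m₂, p₂]
  · exact_mod_cast Finset.card_le_card (boundary_filter_odd_subset_oddEdges G W)

/-- For graphs, the boundary of a single vertex bounds the degree of an expander by the number of
vertices. -/
lemma IsRegularExpander.mul_le_of_two {n d : ℕ} {c : ℝ} {G : UniformHypergraph n 2}
    (hG : IsRegularExpander G d c) (hn : 2 ≤ n) : c * d ≤ n := by
  let a : Fin n := ⟨0, by omega⟩
  have hH : (hypervertices n 2).card = n := by simp [hypervertices]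
  have hn' : (2 : ℝ) ≤ n := by exact_mod_cast hn
  have h := hG {{a}} (by simp [hypervertices]) (by simp)
    (by rw [hH, Finset.card_singleton]; push_cast; linarith)
  have hsub : boundary G {{a}} ⊆ (hypervertices n 2).image fun h ↦ {a} ∪ h := by
    intro e he
    obtain ⟨-, h₁, hm₁, h₂, hm₂, -, rfl⟩ := Finset.mem_filter.mp he
    rw [Finset.mem_singleton.mp hm₁]
    exact Finset.mem_image_of_mem _ (Finset.mem_sdiff.mp hm₂).1
  have hle : ((boundary G {{a}}).card : ℝ) ≤ n := by
    have := (Finset.card_le_card hsub).trans Finset.card_image_le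
    rw [hH] at this
    exact_mod_cast this
  simp only [Finset.card_singleton, Nat.cast_one, mul_one] at h
  exact h.trans hle

/-! ### Exact inference -/

lemma prod_eq_neg_one_pow_mul {n : ℕ} {w y : Fin n → ℝ} {W : Finset (Fin n)}
    (h1 : ∀ i ∈ W, w i = -y i) (h2 : ∀ i ∉ W, w i = y i) (e : Finset (Fin n)) :
    ∏ i ∈ e, w i = (-1) ^ (e ∩ W).card * ∏ i ∈ e, y i := by
  have h : ∀ i ∈ e, w i = (if i ∈ W then -1 else 1) * y i := by
    intro i _
    by_cases hi : i ∈ W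
    · simp [hi, h1 i hi]
    · simp [hi, h2 i hi]
  rw [Finset.prod_congr rfl h, Finset.prod_mul_distrib, Finset.prod_ite, Finset.prod_const,
    Finset.prod_const_one, mul_one, Finset.filter_mem_eq_inter]

/-- Flipping the labels in `W` changes the objective exactly on the hyperedges that meet `W` in an
odd number of vertices. -/
lemma sum_edges_sub_eq {n m : ℕ} (G : UniformHypergraph n m) (x : Finset (Fin n) → ℝ)
    {w y : Fin n → ℝ} {W : Finset (Fin n)} (h1 : ∀ i ∈ W, w i = -y i)
    (h2 : ∀ i ∉ W, w i = y i) :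
    ∑ e ∈ G.edges, x e * ∏ a ∈ e, y a - ∑ e ∈ G.edges, x e * ∏ a ∈ e, w a
      = 2 * ∑ e ∈ oddEdges G W, x e * ∏ a ∈ e, y a := by
  rw [← Finset.sum_sub_distrib, oddEdges, Finset.sum_filter, Finset.mul_sum]
  refine Finset.sum_congr rfl fun e _ ↦ ?_
  rw [prod_eq_neg_one_pow_mul h1 h2]
  split_ifs with h
  · rw [h.neg_one_pow]; ring
  · rw [(Nat.not_odd_iff_even.mp h).neg_one_pow]; ring

lemma exactInference_of_pos {n m : ℕ} (hn : n ≠ 0) (hm : Even m) (hm6 : 6 ≤ m)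
    {G : UniformHypergraph n m} {x : Finset (Fin n) → ℝ} {z y : Fin n → ℝ} (hy : IsLabeling y)
    (hx : ∀ W : Finset (Fin n), W.Nonempty → W ≠ Finset.univ →
      0 < ∑ e ∈ oddEdges G W, x e * ∏ a ∈ e, y a)
    (hz : 0 < ∑ i, z i * y i) : ExactInference (observationTensor G x) z y := by
  refine ⟨isStageOneSolution_iff hn hm hm6 hy fun w hw hwy hwny ↦ ?_,
    isStageTwoSolution_iff hm (by omega) hy hz⟩
  let W : Finset (Fin n) := Finset.univ.filter fun i ↦ w i ≠ y i
  have h1 : ∀ i ∈ W, w i = -y i := by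
    intro i hi
    have hne : w i ≠ y i := (Finset.mem_filter.mp hi).2
    rcases hw i with h | h <;> rcases hy i with h' | h' <;> simp_all
  have h2 : ∀ i ∉ W, w i = y i := by
    intro i hi
    by_contra h
    exact hi (Finset.mem_filter.mpr ⟨Finset.mem_univ i, h⟩)
  have hW : W.Nonempty := by
    by_contra h
    rw [Finset.not_nonempty_iff_eq_empty] at h
    exact hwy (funext fun i ↦ h2 i (by simp [h]))
  have hW' : W ≠ Finset.univ := fun h ↦ hwny (funext fun i ↦ h1 i (by simp [h]))
  rw [tensorInner_observationTensor_outerPower, tensorInner_observationTensor_outerPower]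
  refine mul_lt_mul_of_pos_left ?_ (by positivity)
  have := sum_edges_sub_eq G x h1 h2
  have := hx W hW hW'
  linarith

/-! ### ### Failure probability -/

section Probability

variable {n m : ℕ} {G : UniformHypergraph n m} {y : Fin n → ℝ} {p q c : ℝ}
  {Ω : Type*} [MeasurableSpace Ω] {μ : Measure Ω} [IsProbabilityMeasure μ]
  {x : Finset (Fin n) → Ω → ℝ} {z : Fin n → Ω → ℝ}

lemma IsObservation.measureReal_sum_edges_nonpos_le (hobs : IsObservation G y p q μ x z)
    (hp : p < 1 / 2) (hy : IsLabeling y) {s : Finset (Finset (Fin n))}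
    (hs : s ⊆ G.edges) :
    μ.real {ω | ∑ e ∈ s, x e ω * ∏ a ∈ e, y a ≤ 0} ≤ chernoffBase p ^ s.card := by
  have h := measureReal_sum_sign_nonpos_le (μ := μ) hp
    (ξ := fun e : {e // e ∈ G.edges} ↦ x e) (σ := fun e ↦ ∏ a ∈ e.1, y a)
    (fun e ↦ hy.prod_eq e) (fun e ↦ hobs.edge_measurable e e.2) hobs.edge_indep
    (fun e ↦ hobs.edge_correct e e.2) (fun e ↦ hobs.edge_flipped e e.2)
    (s.subtype (· ∈ G.edges))
  rw [Finset.card_subtype, Finset.filter_true_of_mem fun e he ↦ hs he] at h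
  have hsum : ∀ ω, ∑ e ∈ s.subtype (· ∈ G.edges), x e ω * ∏ a ∈ e.1, y a
      = ∑ e ∈ s, x e ω * ∏ a ∈ e, y a := fun ω ↦
    Finset.sum_subtype_of_mem (fun e ↦ x e ω * ∏ a ∈ e, y a) fun e he ↦ hs he
  simpa only [hsum] using h

lemma IsObservation.measureReal_sum_nodes_nonpos_le (hobs : IsObservation G y p q μ x z)
    (hq : q < 1 / 2) (hy : IsLabeling y) :
    μ.real {ω | ∑ i, z i ω * y i ≤ 0} ≤ chernoffBase q ^ n := by
  simpa using measureReal_sum_sign_nonpos_le hq hy hobs.node_measurable hobs.node_indep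
    hobs.node_correct hobs.node_flipped Finset.univ

/-- The failure probability on an expander is controlled by a union bound over the sets of flipped
labels. -/
lemma one_sub_le_measureReal_exactInference {d : ℕ} (hn : m / 2 + 1 ≤ n) (hm : Even m)
    (hm6 : 6 ≤ m) (hG : IsRegularExpander G d c) (hc : 0 < c) (hp₀ : 0 ≤ p) (hp : p < 1 / 2)
    (hq : q < 1 / 2) (hy : IsLabeling y) (hobs : IsObservation G y p q μ x z) :
    1 - 2 ^ n * chernoffBase p ^ (c * d) - chernoffBase q ^ n ≤
      μ.real {ω | ExactInference (observationTensor G fun e ↦ x e ω) (fun i ↦ z i ω) y} := by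
  classical
  -- The empty and the full set are left out: they correspond to `y` and `-y`, which stage one
  -- cannot distinguish.
  let 𝒲 : Finset (Finset (Fin n)) :=
    Finset.univ.filter fun W ↦ W.Nonempty ∧ W ≠ Finset.univ
  let B : Finset (Fin n) → Set Ω := fun W ↦
    {ω | ∑ e ∈ oddEdges G W, x e ω * ∏ a ∈ e, y a ≤ 0}
  let Z : Set Ω := {ω | ∑ i, z i ω * y i ≤ 0}
  set A : Set Ω :=
    {ω | ExactInference (observationTensor G fun e ↦ x e ω) (fun i ↦ z i ω) y}
  -- Covering the whole space by success and the failure events needs neither measurability of the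
  -- success event nor independence between `x` and `z`.
  have hcover : Set.univ ⊆ (A ∪ ⋃ W ∈ 𝒲, B W) ∪ Z := by
    intro ω _
    by_contra h
    simp only [Set.mem_union, not_or, Set.mem_iUnion, not_exists] at h
    obtain ⟨⟨hA, hB⟩, hZ⟩ := h
    refine hA (exactInference_of_pos (by omega) hm hm6 hy (fun W hW hW' ↦ ?_) (not_le.mp hZ))
    exact not_le.mp (hB W (Finset.mem_filter.mpr ⟨Finset.mem_univ W, hW, hW'⟩))
  have hB : ∀ W ∈ 𝒲, μ.real (B W) ≤ chernoffBase p ^ (c * d) := by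
    intro W hW
    obtain ⟨-, hW, hW'⟩ := Finset.mem_filter.mp hW
    refine (hobs.measureReal_sum_edges_nonpos_le hp hy (Finset.filter_subset _ _)).trans ?_
    rw [← Real.rpow_natCast]
    exact Real.rpow_le_rpow_of_exponent_ge (chernoffBase_pos hp₀ hp) (chernoffBase_lt_one hp).le
      (hG.mul_le_card_oddEdges hc.le (by omega) hn hW hW')
  have hBsum : μ.real (⋃ W ∈ 𝒲, B W) ≤ 2 ^ n * chernoffBase p ^ (c * d) := by
    refine ((measureReal_biUnion_finset_le 𝒲 B).trans (Finset.sum_le_card_nsmul _ _ _ hB)).trans ?_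
    rw [nsmul_eq_mul]
    refine mul_le_mul_of_nonneg_right ?_ (Real.rpow_nonneg (chernoffBase_pos hp₀ hp).le _)
    have hcard : 𝒲.card ≤ 2 ^ n := by
      simpa using Finset.card_le_univ 𝒲
    exact_mod_cast hcard
  have hZ : μ.real Z ≤ chernoffBase q ^ n := hobs.measureReal_sum_nodes_nonpos_le hq hy
  have htotal : 1 ≤ μ.real A + μ.real (⋃ W ∈ 𝒲, B W) + μ.real Z := by
    calc 1 = μ.real Set.univ := probReal_univ.symm
      _ ≤ μ.real ((A ∪ ⋃ W ∈ 𝒲, B W) ∪ Z) := measureReal_mono hcover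
      _ ≤ μ.real (A ∪ ⋃ W ∈ 𝒲, B W) + μ.real Z := measureReal_union_le _ _
      _ ≤ _ := by gcongr; exact measureReal_union_le _ _
  linarith

end Probability

/-! ### Asymptotics -/

lemma natCast_isLittleO_mul_log_rpow {a : ℝ} (ha : 0 < a) :
    (fun n : ℕ ↦ (n : ℝ)) =o[atTop] fun n : ℕ ↦ (n : ℝ) * Real.log n ^ a := by
  have hlog : Tendsto (fun n : ℕ ↦ Real.log n ^ a) atTop atTop :=
    (tendsto_rpow_atTop ha).comp (Real.tendsto_log_atTop.comp tendsto_natCast_atTop_atTop)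
  have h1 : (fun _ : ℕ ↦ (1 : ℝ)) =o[atTop] fun n : ℕ ↦ Real.log n ^ a :=
    (isLittleO_one_left_iff ℝ).mpr (tendsto_norm_atTop_atTop.comp hlog)
  simpa using (isBigO_refl (fun n : ℕ ↦ (n : ℝ)) atTop).mul_isLittleO h1

lemma eventually_mul_le_of_isLittleO {d : ℕ → ℕ}
    (hd : (fun n : ℕ ↦ (n : ℝ)) =o[atTop] fun n ↦ (d n : ℝ)) {K : ℝ} (hK : 0 < K) :
    ∀ᶠ n : ℕ in atTop, K * n ≤ d n := by
  filter_upwards [hd.def (inv_pos.mpr hK)] with n hn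
  simp only [Real.norm_natCast] at hn
  rwa [inv_mul_eq_div, le_div_iff₀' hK] at hn

lemma tendsto_two_pow_mul_rpow {d : ℕ → ℕ}
    (hd : (fun n : ℕ ↦ (n : ℝ)) =o[atTop] fun n ↦ (d n : ℝ)) {b c : ℝ} (hb₀ : 0 < b)
    (hb : b < 1) (hc : 0 < c) :
    Tendsto (fun n ↦ 2 ^ n * b ^ (c * d n)) atTop (𝓝 0) := by
  have hlog : Real.log b < 0 := Real.log_neg hb₀ hb
  have hκ : 0 < c * -Real.log b := mul_pos hc (neg_pos.mpr hlog)
  have hlog4 : 0 < Real.log 4 := Real.log_pos (by norm_num)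
  refine squeeze_zero' (g := fun n : ℕ ↦ (1 / 2 : ℝ) ^ n)
    (Eventually.of_forall fun n ↦ by positivity) ?_
    (tendsto_pow_atTop_nhds_zero_of_lt_one (by norm_num) (by norm_num))
  -- The constant `log 4 / (c * -log b)` is chosen so that `b ^ (c * d n) ≤ 4 ^ (-n)`, which beats
  -- the factor `2 ^ n`.
  filter_upwards [eventually_mul_le_of_isLittleO hd (div_pos hlog4 hκ)] with n hn
  rw [div_mul_eq_mul_div, div_le_iff₀ hκ] at hn
  have h4 : b ^ (c * d n) ≤ (1 / 4 : ℝ) ^ n := by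
    rw [Real.rpow_def_of_pos hb₀, ← Real.rpow_natCast, Real.rpow_def_of_pos (by norm_num),
      one_div, Real.log_inv]
    exact Real.exp_le_exp.mpr (by linarith)
  calc (2 : ℝ) ^ n * b ^ (c * d n) ≤ 2 ^ n * (1 / 4) ^ n := by gcongr
    _ = (1 / 2) ^ n := by rw [← mul_pow]; norm_num

end HypergraphInference

open HypergraphInference

theorem mainTheorem6 (m : ℕ) (hm : m % 4 = 2) (p q c : ℝ) (hp₀ : 0 ≤ p) (hp : p < 1 / 2)
    (hq₀ : 0 ≤ q) (hq : q < 1 / 2) (hc : 0 < c) (d : ℕ → ℕ)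
    (hd : (fun n : ℕ ↦ (n : ℝ) * Real.log n ^ (1 / (2 * m : ℝ))) =O[atTop]
      fun n : ℕ ↦ (d n : ℝ)) :
    ∃ ρ : ℕ → ℝ, Tendsto ρ atTop (𝓝 1) ∧
      ∀ (n : ℕ) (G : HypergraphInference.UniformHypergraph n m),
        HypergraphInference.IsRegularExpander G (d n) c →
        ∀ y : Fin n → ℝ, HypergraphInference.IsLabeling y →
        ∀ {Ω : Type*} [MeasurableSpace Ω] (μ : Measure Ω) [IsProbabilityMeasure μ]
          (x : Finset (Fin n) → Ω → ℝ) (z : Fin n → Ω → ℝ),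
          HypergraphInference.IsObservation G y p q μ x z →
          ρ n ≤ μ.real {ω | HypergraphInference.ExactInference
            (HypergraphInference.observationTensor G fun e ↦ x e ω) (fun i ↦ z i ω) y} := by
  have hm0 : (0 : ℝ) < m := by exact_mod_cast (by omega : 0 < m)
  have hd' : (fun n : ℕ ↦ (n : ℝ)) =o[atTop] fun n ↦ (d n : ℝ) :=
    (natCast_isLittleO_mul_log_rpow (by positivity)).trans_isBigO hd
  -- The value `0` makes the bound trivial for the finitely many `n` that are too small. The
  -- condition `n < c * d n` serves to exclude graphs.
  refine ⟨fun n ↦ if m / 2 + 1 ≤ n ∧ (n : ℝ) < c * d n then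
    1 - 2 ^ n * chernoffBase p ^ (c * d n) - chernoffBase q ^ n else 0, ?_, ?_⟩
  · have hlim : Tendsto (fun n : ℕ ↦ 1 - 2 ^ n * chernoffBase p ^ (c * d n) - chernoffBase q ^ n)
        atTop (𝓝 1) := by
      simpa using (tendsto_const_nhds.sub (tendsto_two_pow_mul_rpow hd' (chernoffBase_pos hp₀ hp)
        (chernoffBase_lt_one hp) hc)).sub (tendsto_pow_atTop_nhds_zero_of_lt_one
          (chernoffBase_pos hq₀ hq).le (chernoffBase_lt_one hq))
    refine hlim.congr' ?_
    -- The constant `2 / c` yields `2 * n ≤ c * d n`, hence the strict inequality for positive `n`.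
    filter_upwards [eventually_ge_atTop (m / 2 + 1),
      eventually_mul_le_of_isLittleO hd' (div_pos two_pos hc)] with n hn hdn
    rw [div_mul_eq_mul_div, div_le_iff₀ hc] at hdn
    have hnpos : (0 : ℝ) < n := by exact_mod_cast (by omega : 0 < n)
    rw [if_pos ⟨hn, by linarith⟩]
  · intro n G hG y hy Ω _ μ _ x z hobs
    dsimp only
    split_ifs with h
    · by_cases hm2 : m = 2
      · subst hm2
        exact absurd (hG.mul_le_of_two (by omega)) (not_le.mpr h.2)
      · exact one_sub_le_measureReal_exactInference h.1 (Nat.even_iff.mpr (by omega)) (by omega)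
          hG hc hp₀ hp hq hy hobs
    · exact measureReal_nonneg
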